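/- Let $k$ be an algebraically closed field and $A$ a basic finite-dimensional $k$-algebra; all modules are finitely generated left $A$-modules. Let $(\Lambda,\leqslant)$ be a finite poset, with height function $h:\Lambda\to\mathbb N$ such that the minimal elements of $\Lambda$ have height $1$ and, for $n\geqslant 1$, the elements of height $n+1$ are the minimal ones among the elements not of height $\leqslant n$. For a family $\Theta_\lambda$ ($\lambda\in\Lambda$) of $A$-modules let $\mathcal F(\Theta)$ be the class of modules having a finite filtration with all factors isomorphic to some $\Theta_\lambda$. Let $(\underline\Theta,\underline Q)$ be an Ext-projective stratifying system indexed by $\Lambda$, that is, a family of nonzero modules $\Theta_\lambda$ and a family of indecomposable modules $Q_\lambda$ such that 1. $\mathrm{Hom}_A(\Theta_\lambda,\Theta_\mu)=0$ if $\lambda\nleqslant\mu$; 2. for each $\lambda$ there is an exact sequence $0\to K_\lambda\to Q_\lambda\to\Theta_\lambda\to 0$ such that $K_\lambda$ has a filtration with factors isomorphic to $\Theta_\mu$ with $\mu>\lambda$; 3. $\mathrm{Ext}^1_A(Q_\lambda,M)=0$ for all $\lambda\in\Lambda$ and $M\in\mathcal F(\Theta)$. Put $\Theta=\bigoplus_\lambda\Theta_\lambda$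 and $Q=\bigoplus_\lambda Q_\lambda$. Assume that $\mathrm{Ext}^s_A(Q,\Theta)=0$ for all $s\geqslant 1$, that each $\Theta_\lambda$ has a simple top $S_\lambda$, and that $S_\lambda\ncong S_\mu$ for $\lambda\neq\mu$. For $M\in\mathcal F(\Theta)$ let $\mathrm{supp}(M)$ be the set of $\lambda$ such that $\Theta_\lambda$ is isomorphic to a factor of some $\Theta$-filtration of $M$, and, if $M\neq 0$, let $\min(M)=\min\{h(\lambda):\lambda\in\mathrm{supp}(M)\}$. A nonzero $M\in\mathcal F(\Theta)$ is generated in height $i$ if $\min(M)=i$ and there is an exact sequence $0\to M[1]\to M\to\bigoplus_{h(\lambda)=i}\Theta_\lambda^{\oplus m_\lambda}\to 0$ with $M[1]\in\mathcal F(\Theta)$, with $h(\mu)>i$ for all $\mu\in\mathrm{supp}(M[1])$, and with $M/\mathrm{rad}\,M\cong\bigoplus_{h(\lambda)=i}S_\lambda^{\oplus m_\lambda}$; the zero module is regarded as generated in every height. A relative projective cover of $M\in\mathcal F(\Theta)$ is a surjection $f:P\to M$ with $P$ a direct summand of some $Q^{\oplus n}$ and $\ker f\in\mathcal F(\Theta)$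 such that every $g\in\mathrm{End}_A(P)$ with $fg=f$ is bijective; its kernel is the relative syzygy $\Omega_\Theta(M)$, and $\Omega^s_\Theta$ denotes the $s$-th iterate. A module $M\in\mathcal F(\Theta)$ is linearly filtered if there is $i\in\mathbb N$ such that $\Omega^s_\Theta(M)$ is generated in height $i+s$ for all $s\geqslant 0$. Suppose that $\mathrm{Hom}_A(Q,\Theta)\cong\mathrm{Hom}_A(\Theta,\Theta)$ as left $\mathrm{End}_A(\Theta)$-modules and that all $\Theta_\lambda$, $\lambda\in\Lambda$, are linearly filtered. If $M\in\mathcal F(\Theta)$ is linearly filtered, then $$\mathrm{Ext}^{i+1}_A(M,\Theta)=\mathrm{Ext}^1_A(\Theta,\Theta)\cdot\mathrm{Ext}^i_A(M,\Theta)\qquad\text{for all } i\geqslant 0,$$ where the right-hand side is the set of finite sums of Yoneda products; and $\mathrm{Ext}^*_A(M,\Theta)=\bigoplus_{n\geqslant 0}\mathrm{Ext}^n_A(M,\Theta)$, as a graded left module over $\Gamma=\mathrm{Ext}^*_A(\Theta,\Theta)$, is generated in degree $0$, i.e. by $\mathrm{Hom}_A(M,\Theta)$. -/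

import Mathlib

open CategoryTheory CategoryTheory.Abelian

universe u v

namespace EPSS

section Modules

variable {A : Type u} [Ring A]

/-- A nonzero module which is not the direct sum of two nonzero submodules. -/
def IsIndecomposable (A : Type u) [Ring A] (M : Type u) [AddCommGroup M] [Module A M] : Prop :=
  Nontrivial M ∧ ∀ N N' : Submodule A M, IsCompl N N' → N = ⊥ ∨ N' = ⊥

/-- A ring is basic if the regular left module is a finite direct sum of pairwise non-isomorphic
indecomposable left modules. -/
def IsBasic (A : Type u) [Ring A] : Prop :=
  ∃ (n : ℕ) (P : Fin n → Submodule A A), DirectSum.IsInternal P ∧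
    (∀ i, IsIndecomposable A (P i)) ∧ ∀ i j, Nonempty (P i ≃ₗ[A] P j) → i = j

/-- The top `M / rad M` of a module, `rad M` being the intersection of the maximal submodules. -/
abbrev Top (A : Type u) [Ring A] (M : Type u) [AddCommGroup M] [Module A M] : Type u :=
  M ⧸ Module.jacobson A M

variable {Λ : Type u} (Θ Q : Λ → ModuleCat.{u} A)

/-- The direct sum of a finite family of modules, realised on the product. -/
abbrev dirSum (X : Λ → ModuleCat.{u} A) : ModuleCat.{u} A :=
  ModuleCat.of A (∀ l, X l)

/-- A `Θ`-filtration of `M`: a finite chain `0 = M₀ ⊆ M₁ ⊆ ⋯ ⊆ Mₙ = M` of submodules together with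
labels such that the successive factor number `j` is isomorphic to `Θ (label j)`. -/
structure Filtration (M : Type u) [AddCommGroup M] [Module A M] where
  n : ℕ
  sub : Fin (n + 1) → Submodule A M
  sub_zero : sub 0 = ⊥
  sub_last : sub (Fin.last n) = ⊤
  mono : ∀ j : Fin n, sub j.castSucc ≤ sub j.succ
  label : Fin n → Λ
  factor : ∀ j : Fin n, Nonempty
    ((sub j.succ ⧸ (sub j.castSucc).submoduleOf (sub j.succ)) ≃ₗ[A] Θ (label j))

/-- Membership in `F(Θ)`. -/
def InF (M : Type u) [AddCommGroup M] [Module A M] : Prop :=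
  Nonempty (Filtration Θ M)

/-- The set of all `l` such that `M` has a `Θ`-filtration with a factor isomorphic to `Θ l`. -/
def supp (M : Type u) [AddCommGroup M] [Module A M] : Set Λ :=
  {l | ∃ (F : Filtration Θ M) (j : Fin F.n), F.label j = l}

/-- Membership in `add(Q)`: direct summands of finite direct sums of copies of `⨁ Q l`. -/
def InAdd (P : Type u) [AddCommGroup P] [Module A P] : Prop :=
  ∃ (n : ℕ) (s : P →ₗ[A] (Fin n → dirSum Q)) (r : (Fin n → dirSum Q) →ₗ[A] P),
    r ∘ₗ s = LinearMap.id

/-- Relative projective covers in `F(Θ)`: surjections from a module in `add(Q)` with kernel in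
`F(Θ)` which are right minimal. -/
structure IsRelProjCover {P M : Type u} [AddCommGroup P] [Module A P] [AddCommGroup M] [Module A M]
    (f : P →ₗ[A] M) : Prop where
  inAdd : InAdd Q P
  surjective : Function.Surjective f
  ker_inF : InF Θ (LinearMap.ker f)
  minimal : ∀ g : P →ₗ[A] P, f ∘ₗ g = f → Function.Bijective g

/-- `K` is a first relative syzygy of `M`: the kernel of a relative projective cover. -/
def IsRelSyzygy (K M : Type u) [AddCommGroup K] [Module A K] [AddCommGroup M] [Module A M] : Prop :=
  ∃ (P : ModuleCat.{u} A) (f : P →ₗ[A] M), IsRelProjCover Θ Q f ∧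
    Nonempty (K ≃ₗ[A] LinearMap.ker f)

variable [PartialOrder Λ]

/-- An Ext-projective stratifying system `(Θ, Q)` of finitely generated modules indexed by `Λ`. -/
structure IsEPSS : Prop where
  finite_Θ : ∀ l, Module.Finite A (Θ l)
  nontrivial_Θ : ∀ l, Nontrivial (Θ l)
  finite_Q : ∀ l, Module.Finite A (Q l)
  indecomposable_Q : ∀ l, IsIndecomposable A (Q l)
  hom_eq_zero : ∀ l m, ¬ l ≤ m → ∀ f : Θ l →ₗ[A] Θ m, f = 0
  exact_seq : ∀ l, ∃ f : Q l →ₗ[A] Θ l, Function.Surjective f ∧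
    ∃ F : Filtration Θ (LinearMap.ker f), ∀ j, l < F.label j
  ext_eq_zero : ∀ (l : Λ) (M : ModuleCat.{u} A), InF Θ M → Subsingleton (Ext.{u} (Q l) M 1)

/-- The standing conditions: `Extˢ(Q, Θ) = 0` for `s ≥ 1`, each `Θ l` has a simple top, and these
tops are pairwise non-isomorphic. -/
structure StandingConditions : Prop where
  ext_eq_zero : ∀ s : ℕ, 1 ≤ s → Subsingleton (Ext.{u} (dirSum Q) (dirSum Θ) s)
  simple_top : ∀ l, IsSimpleModule A (Top A (Θ l))
  top_injective : ∀ l m, Nonempty (Top A (Θ l) ≃ₗ[A] Top A (Θ m)) → l = m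

/-- The height of an element of a finite poset: minimal elements have height `1`, the minimal
elements among the remaining ones have height `2`, and so on. (`Order.height l` is the supremum of
the lengths `n` of chains `l₀ < ⋯ < lₙ = l`.) -/
noncomputable def ht (l : Λ) : ℕ := (Order.height l).toNat + 1

/-- `M ∈ F(Θ)` is generated in height `i`: one has `min(M) = i`, and in the exact sequence
`0 → M[1] → M → ⨁_{ht l = i} (Θ l)^(m l) → 0` with `M[1] ∈ F(Θ)` and `min(M[1]) > i`,
the middle and the right hand term have isomorphic tops. -/
def GeneratedInHeight (i : ℕ) (M : Type u) [AddCommGroup M] [Module A M] : Prop :=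
  InF Θ M ∧ IsLeast (ht '' supp Θ M) i ∧
    ∃ (m : {l : Λ // ht l = i} → ℕ) (f : M →ₗ[A] (∀ l, Fin (m l) → Θ l.1)),
      Function.Surjective f ∧ InF Θ (LinearMap.ker f) ∧
      (∀ l ∈ supp Θ (LinearMap.ker f), i < ht l) ∧
      Nonempty (Top A M ≃ₗ[A] Top A (∀ l, Fin (m l) → Θ l.1))

/-- `M ∈ F(Θ)` is linearly filtered: for some `i`, its iterated relative syzygies `X s` are
generated in height `i + s` for all `s ≥ 0`, where the zero module counts as generated in every
height (the iterated relative syzygies of `M` are eventually zero). -/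
def LinearlyFiltered (M : Type u) [AddCommGroup M] [Module A M] : Prop :=
  InF Θ M ∧ ∃ (i : ℕ) (X : ℕ → ModuleCat.{u} A), Nonempty (X 0 ≃ₗ[A] M) ∧
    (∀ s, IsRelSyzygy Θ Q (X (s + 1)) (X s)) ∧
    ∀ s, Subsingleton (X s) ∨ GeneratedInHeight Θ (i + s) (X s)

end Modules

section ExtAlgebra

variable {A : Type u} [Ring A]

/-- The graded pieces of `Ext*(X, Y)`. -/
abbrev ExtFam (X Y : ModuleCat.{u} A) (n : ℕ) : Type u := Ext.{u} X Y n

/-- The Yoneda product `x · y`, with maps composed from right to left (first `y`, then `x`);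
`Ext.comp` is written the other way round. -/
noncomputable def yoneda {M X Y : ModuleCat.{u} A} {a b : ℕ} (x : Ext.{u} X Y a)
    (y : Ext.{u} M X b) : Ext.{u} M Y (a + b) :=
  y.comp x (add_comm b a)

lemma yoneda_assoc {X Y Z W : ModuleCat.{u} A} {a b c : ℕ}
    (x : Ext.{u} Z W a) (y : Ext.{u} Y Z b) (z : Ext.{u} X Y c) :
    (⟨(a + b) + c, yoneda (yoneda x y) z⟩ : GradedMonoid (ExtFam X W)) =
      ⟨a + (b + c), yoneda x (yoneda y z)⟩ := by
  have key : ∀ (n n' : ℕ) (h : c + (a + b) = n) (h' : (b + c) + a = n'),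
      (⟨n, z.comp (y.comp x (add_comm b a)) h⟩ : GradedMonoid (ExtFam X W)) =
        ⟨n', (z.comp y (add_comm c b)).comp x h'⟩ := by
    intro n n' h h'
    obtain rfl : n = n' := by omega
    rw [Ext.comp_assoc z y x (add_comm c b) (add_comm b a) (by omega)]
  exact key _ _ _ _

lemma one_yoneda {X Y : ModuleCat.{u} A} {a : ℕ} (x : Ext.{u} X Y a) :
    (⟨0 + a, yoneda (Ext.mk₀ (𝟙 Y)) x⟩ : GradedMonoid (ExtFam X Y)) = ⟨a, x⟩ := by
  have key : ∀ (n : ℕ) (h : a + 0 = n),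
      (⟨n, x.comp (Ext.mk₀ (𝟙 Y)) h⟩ : GradedMonoid (ExtFam X Y)) = ⟨a, x⟩ := by
    intro n h
    obtain rfl : a = n := h
    rw [Ext.comp_mk₀_id]
  exact key _ _

lemma yoneda_one {X Y : ModuleCat.{u} A} {a : ℕ} (x : Ext.{u} X Y a) :
    (⟨a + 0, yoneda x (Ext.mk₀ (𝟙 X))⟩ : GradedMonoid (ExtFam X Y)) = ⟨a, x⟩ := by
  have key : ∀ (n : ℕ) (h : 0 + a = n),
      (⟨n, (Ext.mk₀ (𝟙 X)).comp x h⟩ : GradedMonoid (ExtFam X Y)) = ⟨a, x⟩ := by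
    intro n h
    obtain rfl : a = n := by omega
    rw [Ext.mk₀_id_comp]
  exact key _ _

lemma yoneda_zero {M X Y : ModuleCat.{u} A} {a b : ℕ} (x : Ext.{u} X Y a) :
    yoneda x (0 : Ext.{u} M X b) = 0 := by
  simp [yoneda]

lemma zero_yoneda {M X Y : ModuleCat.{u} A} {a b : ℕ} (y : Ext.{u} M X b) :
    yoneda (0 : Ext.{u} X Y a) y = 0 := by
  simp [yoneda]

lemma yoneda_add {M X Y : ModuleCat.{u} A} {a b : ℕ} (x : Ext.{u} X Y a) (y z : Ext.{u} M X b) :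
    yoneda x (y + z) = yoneda x y + yoneda x z := by
  simp [yoneda]

lemma add_yoneda {M X Y : ModuleCat.{u} A} {a b : ℕ} (x y : Ext.{u} X Y a) (z : Ext.{u} M X b) :
    yoneda (x + y) z = yoneda x z + yoneda y z := by
  simp [yoneda]

noncomputable instance extGMul (X : ModuleCat.{u} A) : GradedMonoid.GMul (ExtFam X X) where
  mul x y := yoneda x y

noncomputable instance extGOne (X : ModuleCat.{u} A) : GradedMonoid.GOne (ExtFam X X) where
  one := Ext.mk₀ (𝟙 X)

noncomputable instance extGMonoid (X : ModuleCat.{u} A) : GradedMonoid.GMonoid (ExtFam X X) where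
  one_mul x := one_yoneda x.2
  mul_one x := yoneda_one x.2
  mul_assoc x y z := yoneda_assoc x.2 y.2 z.2

/-- The graded ring structure on `Γ = ⨁ₙ Extⁿ(X, X)` given by the Yoneda product. -/
noncomputable instance extGSemiring (X : ModuleCat.{u} A) : DirectSum.GSemiring (ExtFam X X) where
  toGMonoid := extGMonoid X
  mul_zero x := yoneda_zero x
  zero_mul x := zero_yoneda x
  mul_add x y z := yoneda_add x y z
  add_mul x y z := add_yoneda x y z
  natCast n := n • Ext.mk₀ (𝟙 X)
  natCast_zero := zero_nsmul _
  natCast_succ n := succ_nsmul (Ext.mk₀ (𝟙 X)) n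

noncomputable instance extGSMul (M X : ModuleCat.{u} A) :
    GradedMonoid.GSMul (ExtFam X X) (ExtFam M X) where
  smul x y := yoneda x y

noncomputable instance extGMulAction (M X : ModuleCat.{u} A) :
    GradedMonoid.GMulAction (ExtFam X X) (ExtFam M X) where
  one_smul := fun ⟨_, y⟩ => one_yoneda y
  mul_smul := fun ⟨_, x⟩ ⟨_, y⟩ ⟨_, z⟩ => yoneda_assoc x y z

/-- The graded left `Ext*(X, X)`-module structure on `⨁ₙ Extⁿ(M, X)` given by the Yoneda
product. -/
noncomputable instance extGmodule (M X : ModuleCat.{u} A) :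
    DirectSum.Gmodule (ExtFam X X) (ExtFam M X) where
  toGMulAction := extGMulAction M X
  smul_add x y z := yoneda_add x y z
  smul_zero x := yoneda_zero x
  add_smul x y z := add_yoneda x y z
  zero_smul y := zero_yoneda y

/-- The extension algebra `Γ = Ext*(X, X)`. -/
abbrev ExtAlg (X : ModuleCat.{u} A) : Type u := DirectSum ℕ (ExtFam X X)

/-- The graded `Ext*(X, X)`-module `Ext*(M, X)`. -/
abbrev ExtMod (M X : ModuleCat.{u} A) : Type u := DirectSum ℕ (ExtFam M X)

/-- `Ext¹(X, X) · Extⁱ(M, X) ⊆ Extⁱ⁺¹(M, X)`: all finite sums of Yoneda products `x · y`. -/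
noncomputable def extOneMul (M X : ModuleCat.{u} A) (i : ℕ) : AddSubgroup (Ext.{u} M X (i + 1)) :=
  AddSubgroup.closure {z | ∃ (x : Ext.{u} X X 1) (y : Ext.{u} M X i), z = y.comp x rfl}

end ExtAlgebra

end EPSS

namespace EPSS
-- Long exact sequences of Ext and decompositions into direct summands
section Extensions

variable {A : Type u} [Ring A]

/-! Let `0 → N → P → M → 0` be a relative projective cover. Since Ext from `P` to `Θ` vanishes in
positive degrees, the connecting map `Extⁿ(N, Θ) → Extⁿ⁺¹(M, Θ)` is onto, and it commutes with
multiplication by `Ext¹(Θ, Θ)`. Everything thus descends along the iterated syzygies to degree one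
(`extOneMul_succ_eq_top`), where the claim is `Ext¹(M, Θ) = Ext¹(Θ, Θ) · Hom(M, Θ)`
(`extOneMul_zero_eq_top`).

There a class is the pushout of the cover along some `f : N → Θ`, and the heights enter through two
facts. First, `f` factors over the quotient `T'` of `N`, a sum of `Θ`'s of height `i + 1`
(`hom_factors`). This rests on the Hom hypothesis: by counting dimensions, every map `Q l → Θ m`
factors over `Θ l`. Second, the pushout in `Ext¹(M, T')` comes from the height-`i` quotient `T` of
`M`: the kernel `M1` has factors of height at least `i + 1`, and `Ext¹(Θ l, Θ m) ≠ 0` forces `l <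
m`, so `Ext¹(M1, T') = 0`. Hence the class is a map `M → T` followed by a class in `Ext¹(T, Θ)`. As
`T` is a sum of `Θ`'s, this is a sum of the required products. -/

lemma shortExact_of_exact {K P M : ModuleCat.{u} A} (i : K →ₗ[A] P) (f : P →ₗ[A] M)
    (hi : Function.Injective i) (hex : Function.Exact i f) (hf : Function.Surjective f) :
    (ShortComplex.mk (ModuleCat.ofHom i) (ModuleCat.ofHom f)
      (by ext x; exact hex.apply_apply_eq_zero x)).ShortExact where
  exact := (ShortComplex.ShortExact.moduleCat_exact_iff_function_exact _).2 hex
  mono_f := (ModuleCat.mono_iff_injective _).2 hi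
  epi_g := (ModuleCat.epi_iff_surjective _).2 hf

lemma ext_comp_eq_sum {X Y : ModuleCat.{u} A} {ι : Type*} [Fintype ι] {n : ℕ}
    {W : ι → ModuleCat.{u} A} (p : ∀ c, Y ⟶ W c) (q : ∀ c, W c ⟶ Y)
    (h : ∑ c, p c ≫ q c = 𝟙 Y) (x : Ext.{u} X Y n) :
    x = ∑ c, (x.comp (Ext.mk₀ (p c)) (add_zero n)).comp (Ext.mk₀ (q c)) (add_zero n) := by
  conv_lhs => rw [← Ext.comp_mk₀_id x, ← h, Ext.mk₀_sum, Ext.comp_sum]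
  refine Finset.sum_congr rfl fun c _ => ?_
  rw [Ext.comp_assoc_of_third_deg_zero, Ext.mk₀_comp_mk₀]

lemma sum_comp_ext_eq {Y Z : ModuleCat.{u} A} {ι : Type*} [Fintype ι] {n : ℕ}
    {W : ι → ModuleCat.{u} A} (p : ∀ c, Y ⟶ W c) (q : ∀ c, W c ⟶ Y)
    (h : ∑ c, p c ≫ q c = 𝟙 Y) (x : Ext.{u} Y Z n) :
    x = ∑ c, (Ext.mk₀ (p c)).comp ((Ext.mk₀ (q c)).comp x (zero_add n)) (zero_add n) := by
  conv_lhs => rw [← Ext.mk₀_id_comp x, ← h, Ext.mk₀_sum, Ext.sum_comp]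
  refine Finset.sum_congr rfl fun c _ => ?_
  rw [Ext.mk₀_comp_mk₀_assoc]

lemma subsingleton_ext_of_retract_right {X Y Z : ModuleCat.{u} A} {n : ℕ} (s : Y ⟶ Z) (r : Z ⟶ Y)
    (h : s ≫ r = 𝟙 Y) [Subsingleton (Ext.{u} X Z n)] : Subsingleton (Ext.{u} X Y n) := by
  refine subsingleton_of_forall_eq 0 fun x => ?_
  rw [ext_comp_eq_sum (ι := Unit) (fun _ => s) (fun _ => r) (by simpa using h) x]
  simp [Subsingleton.elim (x.comp (Ext.mk₀ s) (add_zero n)) 0]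

lemma subsingleton_ext_of_retract_left {X Y Z : ModuleCat.{u} A} {n : ℕ} (s : X ⟶ Z) (r : Z ⟶ X)
    (h : s ≫ r = 𝟙 X) [Subsingleton (Ext.{u} Z Y n)] : Subsingleton (Ext.{u} X Y n) := by
  refine subsingleton_of_forall_eq 0 fun x => ?_
  rw [sum_comp_ext_eq (ι := Unit) (fun _ => s) (fun _ => r) (by simpa using h) x]
  simp [Subsingleton.elim ((Ext.mk₀ r).comp x (zero_add n)) 0]

lemma subsingleton_ext_of_equiv_left {X Z Y : ModuleCat.{u} A} {n : ℕ} (e : X ≃ₗ[A] Z)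
    [Subsingleton (Ext.{u} Z Y n)] : Subsingleton (Ext.{u} X Y n) :=
  subsingleton_ext_of_retract_left (ModuleCat.ofHom e.toLinearMap)
    (ModuleCat.ofHom e.symm.toLinearMap) (by ext x; simp)

lemma sum_proj_single {ι : Type*} [Fintype ι] [DecidableEq ι] (m : ι → ℕ)
    (Y : ι → Type u) [∀ l, AddCommGroup (Y l)] [∀ l, Module A (Y l)]
    (x : ∀ l, Fin (m l) → Y l) :
    ∑ c : Σ l, Fin (m l), Pi.single (M := fun l => Fin (m l) → Y l) c.1
      (Pi.single c.2 (x c.1 c.2)) = x := by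
  rw [Fintype.sum_sigma]
  ext l a
  rw [Finset.sum_apply, Finset.sum_apply, Finset.sum_eq_single l, Finset.sum_apply,
    Finset.sum_apply, Finset.sum_eq_single a]
  · simp
  · intro b _ hb; simp [hb.symm]
  · simp
  · intro l' _ hl; simp [hl.symm]
  · simp

/-- The coordinate projection of a product of powers. -/
abbrev coordProj {ι : Type u} (m : ι → ℕ) (Y : ι → ModuleCat.{u} A) (c : Σ l, Fin (m l)) :
    ModuleCat.of A (∀ l, Fin (m l) → Y l) ⟶ Y c.1 :=
  ModuleCat.ofHom (LinearMap.proj c.2 ∘ₗ LinearMap.proj c.1)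

/-- The coordinate inclusion into a product of powers. -/
abbrev coordIncl {ι : Type u} [DecidableEq ι] (m : ι → ℕ) (Y : ι → ModuleCat.{u} A)
    (c : Σ l, Fin (m l)) : Y c.1 ⟶ ModuleCat.of A (∀ l, Fin (m l) → Y l) :=
  ModuleCat.ofHom (LinearMap.single A (fun l => Fin (m l) → Y l) c.1 ∘ₗ
    LinearMap.single A (fun _ => Y c.1) c.2)

lemma sum_coordProj_coordIncl {ι : Type u} [Fintype ι] [DecidableEq ι] (m : ι → ℕ)
    (Y : ι → ModuleCat.{u} A) :
    ∑ c, coordProj m Y c ≫ coordIncl m Y c = 𝟙 _ := by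
  refine ModuleCat.hom_ext (LinearMap.ext fun x => ?_)
  rw [ModuleCat.hom_sum, LinearMap.sum_apply]
  exact sum_proj_single (A := A) m (fun l => Y l) x

lemma lift_of_subsingleton_ext {X K P M : ModuleCat.{u} A} {i : K →ₗ[A] P} {f : P →ₗ[A] M}
    (hi : Function.Injective i) (hex : Function.Exact i f) (hf : Function.Surjective f)
    [Subsingleton (Ext.{u} X K 1)] (g : X →ₗ[A] M) : ∃ h : X →ₗ[A] P, f ∘ₗ h = g := by
  obtain ⟨y, hy⟩ := Ext.covariant_sequence_exact₃ X (shortExact_of_exact i f hi hex hf)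
    (Ext.mk₀ (ModuleCat.ofHom g)) (n₁ := 1) rfl (Subsingleton.elim (α := Ext.{u} X K 1) _ _)
  obtain ⟨h, rfl⟩ := Ext.mk₀_bijective _ _ |>.2 y
  refine ⟨h.hom, ?_⟩
  rw [Ext.mk₀_comp_mk₀] at hy
  exact congrArg ModuleCat.Hom.hom ((Ext.mk₀_bijective _ _).1 hy)

lemma subsingleton_ext_middle {K P M Y : ModuleCat.{u} A} {i : K →ₗ[A] P} {f : P →ₗ[A] M}
    (hi : Function.Injective i) (hex : Function.Exact i f) (hf : Function.Surjective f) {n : ℕ}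
    [Subsingleton (Ext.{u} K Y n)] [Subsingleton (Ext.{u} M Y n)] :
    Subsingleton (Ext.{u} P Y n) := by
  refine subsingleton_of_forall_eq 0 fun x => ?_
  obtain ⟨y, rfl⟩ := Ext.contravariant_sequence_exact₂ (shortExact_of_exact i f hi hex hf) Y x
    (Subsingleton.elim (α := Ext.{u} K Y n) _ _)
  rw [Subsingleton.elim (α := Ext.{u} M Y n) y 0, Ext.comp_zero]

/-- `Ext¹(M, Y)` sits between `Hom(K, Y)` and `Ext¹(P, Y)` in the long exact sequence. -/
lemma subsingleton_ext_one_right {K P M Y : ModuleCat.{u} A} {i : K →ₗ[A] P} {f : P →ₗ[A] M}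
    (hi : Function.Injective i) (hex : Function.Exact i f) (hf : Function.Surjective f)
    [Subsingleton (Ext.{u} P Y 1)] (h0 : ∀ g : K →ₗ[A] Y, g = 0) :
    Subsingleton (Ext.{u} M Y 1) := by
  refine subsingleton_of_forall_eq 0 fun x => ?_
  obtain ⟨y, rfl⟩ := Ext.contravariant_sequence_exact₃ (shortExact_of_exact i f hi hex hf) Y x
    (Subsingleton.elim (α := Ext.{u} P Y 1) _ _) (n₀ := 0) rfl
  obtain ⟨h, rfl⟩ := Ext.mk₀_bijective _ _ |>.2 y
  have : h = 0 := ModuleCat.hom_ext (h0 h.hom)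
  rw [this, Ext.mk₀_zero, Ext.comp_zero]

/-! ### Dévissage along filtrations -/

section Filtration

variable {Λ : Type u} {Θ : Λ → ModuleCat.{u} A}

/-- Induction along a filtration: a property stable under isomorphisms and extensions which holds
for `0` and for the factors holds for the filtered module. -/
lemma Filtration.induction (C : ModuleCat.{u} A → Prop)
    (hiso : ∀ X Y : ModuleCat.{u} A, Nonempty (X ≃ₗ[A] Y) → C X → C Y)
    (hzero : ∀ X : ModuleCat.{u} A, Subsingleton X → C X)
    (hext : ∀ (K P M : ModuleCat.{u} A) (i : K →ₗ[A] P) (f : P →ₗ[A] M),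
      Function.Injective i → Function.Exact i f → Function.Surjective f → C K → C M → C P)
    {M : ModuleCat.{u} A} (F : Filtration Θ M) (hF : ∀ j, C (Θ (F.label j))) : C M := by
  have key : ∀ j : Fin (F.n + 1), C (ModuleCat.of A (F.sub j)) := by
    intro j
    induction j using Fin.induction with
    | zero =>
      refine hzero _ ?_
      rw [F.sub_zero]
      exact inferInstanceAs (Subsingleton (⊥ : Submodule A M))
    | succ j ih =>
      obtain ⟨e⟩ := F.factor j
      refine hext (ModuleCat.of A (F.sub j.castSucc)) _
        (ModuleCat.of A (F.sub j.succ ⧸ (F.sub j.castSucc).submoduleOf (F.sub j.succ)))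
        (Submodule.inclusion (F.mono j)) (Submodule.mkQ _)
        (Submodule.inclusion_injective _) ?_ (Submodule.mkQ_surjective _) ih
        (hiso _ _ ⟨e.symm⟩ (hF j))
      rw [LinearMap.exact_iff, Submodule.ker_mkQ, Submodule.range_inclusion]
      rfl
  refine hiso _ _ ⟨?_⟩ (key (Fin.last _))
  exact (LinearEquiv.ofEq _ _ F.sub_last).trans Submodule.topEquiv

lemma Filtration.hom_eq_zero {M Y : ModuleCat.{u} A} (F : Filtration Θ M)
    (h : ∀ j, ∀ g : Θ (F.label j) →ₗ[A] Y, g = 0) (g : M →ₗ[A] Y) : g = 0 := by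
  refine F.induction (fun X => ∀ g : X →ₗ[A] Y, g = 0) ?_ ?_ ?_ h g
  · rintro X X' ⟨e⟩ hX g
    ext x
    have := LinearMap.congr_fun (hX (g ∘ₗ e.toLinearMap)) (e.symm x)
    simpa using this
  · intro X hX g
    ext x
    rw [Subsingleton.elim x 0, map_zero, map_zero]
  · intro K P N i f _ hex hf hK hN g
    have hker : LinearMap.ker f ≤ LinearMap.ker g := by
      intro x hx
      obtain ⟨y, rfl⟩ := (hex x).1 hx
      exact LinearMap.congr_fun (hK (g ∘ₗ i)) y
    ext x
    have h2 := hN ((LinearMap.ker f).liftQ g hker ∘ₗ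
      (f.quotKerEquivOfSurjective hf).symm.toLinearMap)
    have h3 := LinearMap.congr_fun h2 (f x)
    have h4 : (f.quotKerEquivOfSurjective hf).symm (f x) = Submodule.Quotient.mk x :=
      (LinearEquiv.symm_apply_eq _).2 rfl
    rw [LinearMap.comp_apply, LinearEquiv.coe_coe, h4] at h3
    exact h3

lemma Filtration.subsingleton_ext {M Y : ModuleCat.{u} A} {n : ℕ} (F : Filtration Θ M)
    (h : ∀ j, Subsingleton (Ext.{u} (Θ (F.label j)) Y n)) : Subsingleton (Ext.{u} M Y n) := by
  refine F.induction (fun X => Subsingleton (Ext.{u} X Y n)) ?_ ?_ ?_ h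
  · rintro X X' ⟨e⟩ _
    exact subsingleton_ext_of_equiv_left e.symm
  · intro X hX
    have hX0 : 𝟙 X = 0 := by ext x; exact Subsingleton.elim _ _
    refine subsingleton_of_forall_eq 0 fun x => ?_
    rw [← Ext.mk₀_id_comp x, hX0, Ext.mk₀_zero, Ext.zero_comp]
  · intro K P N i f hi hex hf _ _
    exact subsingleton_ext_middle hi hex hf

lemma InF.finite {M : ModuleCat.{u} A} (hΘ : ∀ l, Module.Finite A (Θ l)) (hM : InF Θ M) :
    Module.Finite A M := by
  obtain ⟨F⟩ := hM
  refine F.induction (fun X => Module.Finite A X) ?_ ?_ ?_ fun j => hΘ _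
  · rintro X X' ⟨e⟩ _
    exact Module.Finite.equiv e
  · intro X hX
    infer_instance
  · intro K P N i f hi hex hf _ _
    exact Module.Finite.of_exact hex hf

lemma subset_supp (M : ModuleCat.{u} A) (F : Filtration Θ M) (j : Fin F.n) :
    F.label j ∈ supp Θ M := ⟨F, j, rfl⟩

end Filtration

/-! ### Tops, superfluous kernels and heights -/

/-- A surjection between modules with isomorphic tops is superfluous. -/
lemma ker_le_jacobson {N T : Type u} [AddCommGroup N] [Module A N] [AddCommGroup T] [Module A T]
    [IsNoetherian A N] (f : N →ₗ[A] T) (hf : Function.Surjective f)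
    (e : Top A N ≃ₗ[A] Top A T) : LinearMap.ker f ≤ Module.jacobson A N := by
  let φ : Top A N →ₗ[A] Top A T := Submodule.mapQ _ _ f (Module.le_comap_jacobson f)
  have hφ : Function.Surjective φ := by
    intro y
    obtain ⟨t, rfl⟩ := Submodule.mkQ_surjective _ y
    obtain ⟨x, rfl⟩ := hf t
    exact ⟨Submodule.mkQ _ x, rfl⟩
  -- The top of `N` is Noetherian, so the surjective endomorphism obtained from `φ` and `e` is
  -- injective; hence `f x = 0` forces `x` to vanish in the top.
  have hinj : Function.Injective (e.symm.toLinearMap ∘ₗ φ) :=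
    IsNoetherian.injective_of_surjective_endomorphism _ (e.symm.surjective.comp hφ)
  intro x hx
  rw [← Submodule.Quotient.mk_eq_zero]
  apply hinj
  rw [map_zero]
  simp only [LinearMap.comp_apply]
  have : φ (Submodule.Quotient.mk x) = Submodule.Quotient.mk (f x) := rfl
  rw [this, LinearMap.mem_ker.1 hx]
  simp

/-- Nakayama: a proper image of `h` would lie in a maximal submodule; that submodule also contains
the radical, hence `ker f`, and therefore all of `N`. -/
lemma surjective_of_comp_surjective {R N T : Type u} [AddCommGroup N] [Module A N]
    [AddCommGroup T] [Module A T] [AddCommGroup R] [Module A R]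
    [Module.Finite A N] (f : N →ₗ[A] T) (hker : LinearMap.ker f ≤ Module.jacobson A N)
    (h : R →ₗ[A] N) (hfh : Function.Surjective (f ∘ₗ h)) : Function.Surjective h := by
  rw [← LinearMap.range_eq_top]
  by_contra hne
  obtain ⟨U, hU, hle⟩ := (eq_top_or_exists_le_coatom (LinearMap.range h)).resolve_left hne
  refine hU.1 (eq_top_iff.2 fun x _ => ?_)
  obtain ⟨r, hr⟩ := hfh (f x)
  have h1 : x - h r ∈ LinearMap.ker f := by
    rw [LinearMap.mem_ker, map_sub, ← hr, LinearMap.comp_apply, sub_self]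
  have h2 : x - h r ∈ U := (Submodule.mem_sInf.1 (hker h1)) U hU
  simpa using U.add_mem h2 (hle ⟨r, rfl⟩)

lemma ht_lt_ht {Λ : Type u} [Finite Λ] [PartialOrder Λ] {l m : Λ} (h : l < m) : ht l < ht m := by
  -- Finiteness matters because `toNat` sends `⊤` to `0`, which would destroy monotonicity.
  have hfin : ∀ x : Λ, Order.height x < ⊤ := by
    intro x
    have := Fintype.ofFinite Λ
    refine (Order.height_le (n := Fintype.card Λ) fun p _ => ?_).trans_lt (ENat.natCast_lt_top _)
    exact_mod_cast p.length_lt_card.le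
  have h1 := Order.height_strictMono h (hfin l)
  unfold ht
  rw [← ENat.natCast_toNat (hfin l).ne, ← ENat.natCast_toNat (hfin m).ne, Nat.cast_lt] at h1
  omega

end Extensions

/-! ### The Hom hypothesis and dimension counting -/

section Algebra

variable {A : Type u} [Ring A]

/-- Over a finite-dimensional algebra, an injective `End(D)`-linear endomorphism of `Hom(R, D)`
is surjective. -/
lemma surjective_of_injective_end {R D : Type u} [AddCommGroup R] [Module A R]
    [AddCommGroup D] [Module A D] (k : Type v) [Field k] [Algebra k A] [Module.Finite k A]
    [Module.Finite A R] [Module.Finite A D]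
    (φ : (R →ₗ[A] D) →ₗ[Module.End A D] (R →ₗ[A] D)) (hφ : Function.Injective φ) :
    Function.Surjective φ := by
  let := Module.compHom R (algebraMap k A)
  let := Module.compHom D (algebraMap k A)
  have : IsScalarTower k A R := .of_algebraMap_smul fun _ _ => rfl
  have : IsScalarTower k A D := .of_algebraMap_smul fun _ _ => rfl
  have : SMulCommClass A k D := IsScalarTower.to_smulCommClass'
  have : SMulCommClass A k R := IsScalarTower.to_smulCommClass'
  have : Module.Finite k R := Module.Finite.trans A R
  have : Module.Finite k D := Module.Finite.trans A D
  let ρ : (R →ₗ[A] D) →ₗ[k] (R →ₗ[k] D) :=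
    { toFun := fun f => f.restrictScalars k
      map_add' := fun _ _ => rfl
      map_smul' := fun _ _ => rfl }
  have hρ : Function.Injective ρ := LinearMap.restrictScalars_injective k
  have : Module.Finite k (R →ₗ[A] D) := Module.Finite.of_injective ρ hρ
  let ψ : (R →ₗ[A] D) →ₗ[k] (R →ₗ[A] D) :=
    { toFun := φ
      map_add' := φ.map_add
      -- Scalars of `k` act on `Hom(R, D)` through `End(D)`, so `φ` is `k`-linear and dimensions can
      -- be compared.
      map_smul' := fun c f => by
        have h := φ.map_smul (c • (LinearMap.id : D →ₗ[A] D) : Module.End A D) f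
        exact h }
  exact (LinearMap.injective_iff_surjective (f := ψ)).1 hφ

variable {Λ : Type u} {Θ Q : Λ → ModuleCat.{u} A}

/-- The given isomorphism `e` is abstract and need not be induced by `p`. Precomposition with `⨁ p`
is nevertheless an injection from `Hom(Θ, Θ)` to `Hom(Q, Θ)`; after `e` it becomes an injective
endomorphism of a finite-dimensional space, hence is onto. So every map from `Q` to `Θ` factors over
`⨁ p`. -/
lemma ker_le_ker_of_hom_equiv [Finite Λ] (k : Type v) [Field k] [Algebra k A] [Module.Finite k A]
    (hΘ : ∀ l, Module.Finite A (Θ l)) (hQ : ∀ l, Module.Finite A (Q l))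
    (hHom : Nonempty ((dirSum Q →ₗ[A] dirSum Θ)
      ≃ₗ[Module.End A (dirSum Θ)] (dirSum Θ →ₗ[A] dirSum Θ)))
    (p : ∀ l, Q l →ₗ[A] Θ l) (hp : ∀ l, Function.Surjective (p l)) (l m : Λ)
    (h : Q l →ₗ[A] Θ m) : LinearMap.ker (p l) ≤ LinearMap.ker h := by
  classical
  obtain ⟨e⟩ := hHom
  let π : dirSum Q →ₗ[A] dirSum Θ := LinearMap.piMap p
  have hπ : Function.Surjective π := Function.Surjective.piMap hp
  let pre : (dirSum Θ →ₗ[A] dirSum Θ) →ₗ[Module.End A (dirSum Θ)] (dirSum Q →ₗ[A] dirSum Θ) :=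
    { toFun := fun f => f ∘ₗ π
      map_add' := fun _ _ => rfl
      map_smul' := fun _ _ => rfl }
  have hpre : Function.Injective pre := by
    intro f g hfg
    refine LinearMap.ext fun x => ?_
    obtain ⟨y, rfl⟩ := hπ x
    exact LinearMap.congr_fun hfg y
  obtain ⟨f, hf⟩ := surjective_of_injective_end k (pre ∘ₗ e.toLinearMap)
    (hpre.comp e.injective)
    (LinearMap.single A (fun l => (Θ l : Type u)) m ∘ₗ h ∘ₗ LinearMap.proj l)
  intro x hx
  have h1 := LinearMap.congr_fun hf (Pi.single l x)
  have h2 : π (Pi.single l x) = 0 := by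
    funext j
    change p j (Pi.single (M := fun l => (Q l : Type u)) l x j) = 0
    by_cases hj : j = l
    · subst hj
      rw [Pi.single_eq_same]
      exact hx
    · rw [Pi.single_eq_of_ne hj, map_zero]
  have h3 : e f (π (Pi.single l x)) = Pi.single m (h x) := by
    simpa [pre] using h1
  rw [h2, map_zero] at h3
  have h4 := congrFun h3 m
  rw [Pi.single_eq_same] at h4
  exact h4.symm

end Algebra

/-! ### Generation of Ext by degree-one products -/

section Main

variable {A : Type u} [Ring A] {Λ : Type u} {Θ Q : Λ → ModuleCat.{u} A}

lemma exact_subtype_comp_equiv {N P M : ModuleCat.{u} A} (q : P →ₗ[A] M)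
    (e : N ≃ₗ[A] LinearMap.ker q) :
    Function.Exact ((LinearMap.ker q).subtype ∘ₗ e.toLinearMap) q := by
  rw [LinearMap.exact_iff, LinearMap.range_comp, LinearEquiv.range, Submodule.map_top,
    Submodule.range_subtype]

lemma StandingConditions.subsingleton_ext (hS : StandingConditions Θ Q) (P : ModuleCat.{u} A)
    (hP : InAdd Q P) (n : ℕ) (hn : 1 ≤ n) : Subsingleton (Ext.{u} P (dirSum Θ) n) := by
  obtain ⟨N, s, r, hrs⟩ := hP
  have := hS.ext_eq_zero n hn
  have : Subsingleton (Ext.{u} (ModuleCat.of A (Fin N → dirSum Q)) (dirSum Θ) n) := by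
    refine subsingleton_of_forall_eq 0 fun x => ?_
    rw [sum_comp_ext_eq (W := fun _ : Fin N => dirSum Q)
      (fun c => ModuleCat.ofHom (LinearMap.proj c))
      (fun c => ModuleCat.ofHom (LinearMap.single A (fun _ => (dirSum Q : Type u)) c)) ?_ x]
    · refine Finset.sum_eq_zero fun c _ => ?_
      rw [Subsingleton.elim (α := Ext.{u} (dirSum Q) (dirSum Θ) n) (Ext.comp _ x _) 0,
        Ext.comp_zero]
    · refine ModuleCat.hom_ext (LinearMap.ext fun y => ?_)
      rw [ModuleCat.hom_sum, LinearMap.sum_apply]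
      exact Finset.univ_sum_single y
  exact subsingleton_ext_of_retract_left (ModuleCat.ofHom s) (ModuleCat.ofHom r)
    (ModuleCat.hom_ext hrs)

/-- Dimension shift: `Extⁿ⁺²(P, Θ) = 0` makes the connecting map onto `Extⁿ⁺²(M, Θ)` surjective, and
associativity of the Yoneda product lets it pass through products with `Ext¹(Θ, Θ)`. -/
lemma extOneMul_succ_eq_top (hS : StandingConditions Θ Q) {M N : ModuleCat.{u} A}
    (hMN : IsRelSyzygy Θ Q N M) {n : ℕ} (hN : extOneMul N (dirSum Θ) n = ⊤) :
    extOneMul M (dirSum Θ) (n + 1) = ⊤ := by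
  obtain ⟨P, q, hq, ⟨e⟩⟩ := hMN
  have hses := shortExact_of_exact (K := N) _ q
    ((LinearMap.ker q).injective_subtype.comp e.injective)
    (exact_subtype_comp_equiv q e) hq.surjective
  have := hS.subsingleton_ext P hq.inAdd (n + 1 + 1) (by omega)
  rw [eq_top_iff]
  intro x _
  obtain ⟨y, rfl⟩ := Ext.contravariant_sequence_exact₃ hses (dirSum Θ) x
    (Subsingleton.elim (α := Ext.{u} P (dirSum Θ) (n + 1 + 1)) _ _) (n₀ := n + 1) (by omega)
  have hy : y ∈ extOneMul N (dirSum Θ) n := hN ▸ AddSubgroup.mem_top y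
  refine AddSubgroup.closure_induction
    (p := fun y _ => hses.extClass.comp y (by omega) ∈ extOneMul M (dirSum Θ) (n + 1))
    ?_ ?_ ?_ ?_ hy
  · rintro _ ⟨a, b, rfl⟩
    refine AddSubgroup.subset_closure ⟨a, hses.extClass.comp b (by omega), ?_⟩
    rw [Ext.comp_assoc _ _ _ (by omega) rfl (by omega)]
  · rw [Ext.comp_zero]
    exact zero_mem _
  · intro a b _ _ ha hb
    rw [Ext.comp_add]
    exact add_mem ha hb
  · intro a _ ha
    rw [Ext.comp_neg]
    exact neg_mem ha

variable [PartialOrder Λ]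

/-- `Ext¹(Q l, Θ m) = 0`, so only `Hom(K l, Θ m)` can contribute. The factors of `K l` have labels
above `l`, and a nonzero map from one of them to `Θ m` would give `l < m`. -/
lemma IsEPSS.subsingleton_ext_one (hE : IsEPSS Θ Q) {l m : Λ} (hlm : ¬ l < m) :
    Subsingleton (Ext.{u} (Θ l) (Θ m) 1) := by
  obtain ⟨f, hf, F, hF⟩ := hE.exact_seq l
  let F0 : Filtration Θ (Θ m : Type u) :=
    { n := 1
      sub := ![⊥, ⊤]
      sub_zero := rfl
      sub_last := rfl
      mono := fun j => by fin_cases j; exact bot_le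
      label := fun _ => m
      factor := fun j => by
        fin_cases j
        refine ⟨(Submodule.quotEquivOfEqBot _ ?_).trans Submodule.topEquiv⟩
        exact (Submodule.comap_bot _).trans (Submodule.ker_subtype _) }
  have := hE.ext_eq_zero l (Θ m) ⟨F0⟩
  refine subsingleton_ext_one_right (K := ModuleCat.of A (LinearMap.ker f))
    (LinearMap.ker f).injective_subtype (LinearMap.exact_subtype_ker_map f) hf fun g => ?_
  exact Filtration.hom_eq_zero (M := ModuleCat.of A (LinearMap.ker f)) F
    (fun j g => hE.hom_eq_zero _ _ (fun hle => hlm ((hF j).trans_le hle)) g) g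

/-- Every map from `N`, generated in height `i`, to some `Θ l` factors over the canonical
quotient of `N` which is a direct sum of `Θ`'s of height `i`. -/
lemma hom_factors [Finite Λ] [IsNoetherianRing A] (hE : IsEPSS Θ Q) (p : ∀ l, Q l →ₗ[A] Θ l)
    (hp : ∀ l, Function.Surjective (p l))
    (hker : ∀ l m (h : Q l →ₗ[A] Θ m), LinearMap.ker (p l) ≤ LinearMap.ker h)
    {i : ℕ} {N : ModuleCat.{u} A} (hN : InF Θ N) (m : {l : Λ // ht l = i} → ℕ)
    (t : N →ₗ[A] (∀ l, Fin (m l) → Θ l.1)) (ht : Function.Surjective t)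
    (htF : InF Θ (LinearMap.ker t))
    (e : Top A N ≃ₗ[A] Top A (∀ l, Fin (m l) → Θ l.1)) (f : N →ₗ[A] dirSum Θ) :
    LinearMap.ker t ≤ LinearMap.ker f := by
  classical
  have := Fintype.ofFinite Λ
  have := hN.finite hE.finite_Θ
  have : IsNoetherian A N := isNoetherian_of_isNoetherianRing_of_finite A N
  let T := ModuleCat.of A (∀ l, Fin (m l) → Θ l.1)
  -- The maps `p` lift through `t` because `ker t` lies in `F(Θ)`, on which `Ext¹(Q l, -)` vanishes.
  have hlift : ∀ c : Σ l, Fin (m l), ∃ h : Q c.1.1 →ₗ[A] N,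
      t ∘ₗ h = (coordIncl m (fun l => Θ l.1) c).hom ∘ₗ p c.1.1 := by
    intro c
    have := hE.ext_eq_zero c.1.1 (ModuleCat.of A (LinearMap.ker t)) htF
    exact lift_of_subsingleton_ext (K := ModuleCat.of A (LinearMap.ker t)) (M := T)
      (LinearMap.ker t).injective_subtype (LinearMap.exact_subtype_ker_map t) ht
      ((coordIncl m (fun l => Θ l.1) c).hom ∘ₗ p c.1.1)
  choose h hh using hlift
  let R := ∀ c : Σ l, Fin (m l), Q c.1.1
  let H : R →ₗ[A] N := ∑ c, h c ∘ₗ LinearMap.proj c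
  have hH : ∀ r, H r = ∑ c, h c (r c) := fun r => by
    rw [LinearMap.sum_apply]
    rfl
  have htH : ∀ r, t (H r) = fun l a => p l.1 (r ⟨l, a⟩) := by
    intro r
    rw [hH, map_sum]
    refine Eq.trans (Finset.sum_congr rfl fun c _ => ?_)
      (sum_proj_single (A := A) m (fun l => (Θ l.1 : Type u)) (fun l a => p l.1 (r ⟨l, a⟩)))
    exact LinearMap.congr_fun (hh c) (r c)
  -- `t ∘ H` is a sum of copies of the surjections `p`, and the equality of tops makes `ker t`
  -- superfluous.
  have hsurj : Function.Surjective H := by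
    refine surjective_of_comp_surjective t (ker_le_jacobson t ht e) H fun y => ?_
    choose r hr using fun c : (Σ l, Fin (m l)) => hp c.1.1 (y c.1 c.2)
    refine ⟨r, ?_⟩
    rw [LinearMap.comp_apply, htH]
    funext l a
    exact hr ⟨l, a⟩
  -- An element of `ker t` is the image of a tuple whose entries lie in the kernels of the `p`, and
  -- `hker` says that `f ∘ h c` kills those.
  intro x hx
  obtain ⟨r, rfl⟩ := hsurj x
  have hr : ∀ c, p c.1.1 (r c) = 0 := fun c => by
    have h0 := (htH r).symm.trans hx
    exact congrFun (congrFun h0 c.1) c.2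
  rw [LinearMap.mem_ker, hH, map_sum]
  refine Finset.sum_eq_zero fun c _ => ?_
  ext j
  exact hker c.1.1 j (LinearMap.proj j ∘ₗ f ∘ₗ h c) (hr c)

lemma extOneMul_zero_eq_top [Finite Λ] [IsNoetherianRing A] (hE : IsEPSS Θ Q)
    (hS : StandingConditions Θ Q) (p : ∀ l, Q l →ₗ[A] Θ l)
    (hp : ∀ l, Function.Surjective (p l))
    (hker : ∀ l m (h : Q l →ₗ[A] Θ m), LinearMap.ker (p l) ≤ LinearMap.ker h)
    {i : ℕ} {M N : ModuleCat.{u} A} (hMN : IsRelSyzygy Θ Q N M)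
    (hM : Subsingleton M ∨ GeneratedInHeight Θ i M)
    (hN : Subsingleton N ∨ GeneratedInHeight Θ (i + 1) N) :
    extOneMul M (dirSum Θ) 0 = ⊤ := by
  classical
  have := Fintype.ofFinite Λ
  rw [eq_top_iff]
  intro x _
  rcases hM with hM | ⟨-, -, m, g, hg, ⟨G⟩, hGh, -⟩
  · have : 𝟙 M = 0 := by ext x; exact Subsingleton.elim _ _
    rw [← Ext.mk₀_id_comp x, this, Ext.mk₀_zero, Ext.zero_comp]
    exact zero_mem _
  obtain ⟨P, q, hq, ⟨e⟩⟩ := hMN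
  have hses := shortExact_of_exact (K := N) _ q
    ((LinearMap.ker q).injective_subtype.comp e.injective)
    (exact_subtype_comp_equiv q e) hq.surjective
  have := hS.subsingleton_ext P hq.inAdd 1 le_rfl
  obtain ⟨y, rfl⟩ := Ext.contravariant_sequence_exact₃ hses (dirSum Θ) x
    (Subsingleton.elim (α := Ext.{u} P (dirSum Θ) 1) _ _) (n₀ := 0) rfl
  obtain ⟨f, rfl⟩ := Ext.mk₀_bijective _ _ |>.2 y
  rcases hN with hN | ⟨hNF, -, m', t, ht', htF, -, ⟨e'⟩⟩
  · have : f = 0 := by ext x; rw [Subsingleton.elim x 0, map_zero, map_zero]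
    rw [this, Ext.mk₀_zero, Ext.comp_zero]
    exact zero_mem _
  have hfac := hom_factors hE p hp hker hNF m' t ht' htF e' f.hom
  let T' := ModuleCat.of A (∀ l, Fin (m' l) → Θ l.1)
  let T := ModuleCat.of A (∀ l, Fin (m l) → Θ l.1)
  let M1 := ModuleCat.of A (LinearMap.ker g)
  let f' : T' ⟶ dirSum Θ := ModuleCat.ofHom ((LinearMap.ker t).liftQ f.hom hfac ∘ₗ
    (t.quotKerEquivOfSurjective ht').symm.toLinearMap)
  have hf' : f = (ModuleCat.ofHom t : N ⟶ T') ≫ f' := by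
    refine ModuleCat.hom_ext (LinearMap.ext fun x => ?_)
    have h4 : (t.quotKerEquivOfSurjective ht').symm (t x) = Submodule.Quotient.mk x :=
      (LinearEquiv.symm_apply_eq _).2 rfl
    change f.hom x = (LinearMap.ker t).liftQ f.hom hfac ((t.quotKerEquivOfSurjective ht').symm (t x))
    rw [h4]
    rfl
  -- A nonzero `Ext¹` between factors would need a label of height greater than `i` strictly below
  -- one of height `i + 1`.
  have hM1 : Subsingleton (Ext.{u} M1 T' 1) := by
    have hc : ∀ c : Σ l, Fin (m' l), Subsingleton (Ext.{u} M1 (Θ c.1.1) 1) := fun c =>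
      Filtration.subsingleton_ext (M := M1) G fun j =>
        hE.subsingleton_ext_one fun hlt => by
          have h1 := hGh _ (subset_supp M1 G j)
          have h2 := ht_lt_ht hlt
          have h3 := c.1.2
          omega
    refine subsingleton_of_forall_eq 0 fun z => ?_
    rw [ext_comp_eq_sum _ _ (sum_coordProj_coordIncl m' (fun l => Θ l.1)) z]
    refine Finset.sum_eq_zero fun c _ => ?_
    have := hc c
    rw [Subsingleton.elim (α := Ext.{u} M1 (Θ c.1.1) 1) (Ext.comp z _ _) 0, Ext.zero_comp]
  have hses2 := shortExact_of_exact (K := M1) (M := T) (LinearMap.ker g).subtype g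
    (LinearMap.ker g).injective_subtype (LinearMap.exact_subtype_ker_map g) hg
  -- Pushed out along `t`, the cover restricts to zero on `M1`, so it is pulled back from a class
  -- `z` on `T`.
  obtain ⟨z, hz⟩ := Ext.contravariant_sequence_exact₂ hses2 T'
    (hses.extClass.comp (Ext.mk₀ (ModuleCat.ofHom t : N ⟶ T')) (add_zero 1))
    (Subsingleton.elim (α := Ext.{u} M1 T' 1) _ _)
  have hx : hses.extClass.comp (Ext.mk₀ f) (add_zero 1) =
      (Ext.mk₀ (ModuleCat.ofHom g : M ⟶ T)).comp (z.comp (Ext.mk₀ f') (add_zero 1))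
        (zero_add 1) := by
    rw [← Ext.comp_assoc_of_third_deg_zero]
    erw [hz]
    rw [Ext.comp_assoc_of_third_deg_zero, Ext.mk₀_comp_mk₀, hf']
  erw [hx]
  rw [sum_comp_ext_eq _ _ (sum_coordProj_coordIncl m (fun l => Θ l.1)) (z.comp _ _), Ext.comp_sum]
  refine sum_mem fun c _ => AddSubgroup.subset_closure ?_
  -- The left factor must be a self-extension of `dirSum Θ`, so each summand of `T` is routed
  -- through `dirSum Θ` by the identity `sg ≫ pr = 𝟙`.
  let pr : dirSum Θ ⟶ Θ c.1.1 := ModuleCat.ofHom (LinearMap.proj c.1.1)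
  let sg : Θ c.1.1 ⟶ dirSum Θ :=
    ModuleCat.ofHom (LinearMap.single A (fun l => (Θ l : Type u)) c.1.1)
  have hsp : sg ≫ pr = 𝟙 _ := by
    refine ModuleCat.hom_ext (LinearMap.ext fun x => ?_)
    exact Pi.single_eq_same (M := fun l => (Θ l : Type u)) c.1.1 x
  refine ⟨(Ext.mk₀ pr).comp ((Ext.mk₀ (coordIncl m (fun l => Θ l.1) c)).comp
    (z.comp (Ext.mk₀ f') (add_zero 1)) (zero_add 1)) (zero_add 1),
    Ext.mk₀ (ModuleCat.ofHom g ≫ coordProj m (fun l => Θ l.1) c ≫ sg), ?_⟩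
  rw [Ext.mk₀_comp_mk₀_assoc, Ext.mk₀_comp_mk₀_assoc]
  conv_rhs => rw [← Category.assoc, Ext.mk₀_comp_mk₀_assoc, Category.assoc, hsp, Category.comp_id,
    Ext.mk₀_comp_mk₀_assoc]

lemma extOneMul_eq_top_of_iso {X M D : ModuleCat.{u} A} (e : X ≅ M) {n : ℕ}
    (h : extOneMul X D n = ⊤) : extOneMul M D n = ⊤ := by
  rw [eq_top_iff]
  intro x _
  have hx : x = (Ext.mk₀ e.inv).comp ((Ext.mk₀ e.hom).comp x (zero_add _)) (zero_add _) := by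
    rw [Ext.mk₀_comp_mk₀_assoc, e.inv_hom_id, Ext.mk₀_id_comp]
  rw [hx]
  generalize (Ext.mk₀ e.hom).comp x (zero_add _) = y
  have hy : y ∈ extOneMul X D n := h ▸ AddSubgroup.mem_top y
  refine AddSubgroup.closure_induction
    (p := fun y _ => (Ext.mk₀ e.inv).comp y (zero_add _) ∈ extOneMul M D n) ?_ ?_ ?_ ?_ hy
  · rintro _ ⟨a, b, rfl⟩
    refine AddSubgroup.subset_closure ⟨a, (Ext.mk₀ e.inv).comp b (zero_add _), ?_⟩
    rw [Ext.comp_assoc _ _ _ (by omega) rfl (by omega)]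
  · rw [Ext.comp_zero]
    exact zero_mem _
  · intro a b _ _ ha hb
    rw [Ext.comp_add]
    exact add_mem ha hb
  · intro a _ ha
    rw [Ext.comp_neg]
    exact neg_mem ha

lemma of_comp_eq_smul {M D : ModuleCat.{u} A} {n : ℕ} (a : Ext.{u} D D 1) (b : Ext.{u} M D n) :
    DirectSum.of (ExtFam M D) (n + 1) (b.comp a rfl) =
      (DirectSum.of (ExtFam D D) 1 a : ExtAlg D) • DirectSum.of (ExtFam M D) n b := by
  rw [DirectSum.Gmodule.of_smul_of]
  -- The scalar action lands in degree `1 + n`, the product in degree `n + 1`.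
  have key : ∀ (j : ℕ) (h : n + 1 = j), DirectSum.of (ExtFam M D) (n + 1) (b.comp a rfl) =
      DirectSum.of (ExtFam M D) j (b.comp a h) := by
    rintro _ rfl
    rfl
  exact key _ (add_comm n 1)

lemma span_range_of_zero_eq_top {M D : ModuleCat.{u} A} (h : ∀ n, extOneMul M D n = ⊤) :
    Submodule.span (ExtAlg D) (Set.range (DirectSum.of (ExtFam M D) 0)) = ⊤ := by
  have key : ∀ n (x : Ext.{u} M D n), DirectSum.of (ExtFam M D) n x ∈
      Submodule.span (ExtAlg D) (Set.range (DirectSum.of (ExtFam M D) 0)) := by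
    intro n
    induction n with
    | zero => exact fun x => Submodule.subset_span ⟨x, rfl⟩
    | succ n ih =>
      intro x
      have hx : x ∈ extOneMul M D n := h n ▸ AddSubgroup.mem_top x
      -- The Ext algebra carries only a semiring structure here, so `y` and `-y` are treated
      -- together to obtain closure under negation.
      refine AddSubgroup.closure_induction (p := fun y _ =>
        DirectSum.of (ExtFam M D) (n + 1) y ∈
          Submodule.span (ExtAlg D) (Set.range (DirectSum.of (ExtFam M D) 0)) ∧
        DirectSum.of (ExtFam M D) (n + 1) (-y) ∈
          Submodule.span (ExtAlg D) (Set.range (DirectSum.of (ExtFam M D) 0))) ?_ ?_ ?_ ?_ hx |>.1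
      · rintro _ ⟨a, b, rfl⟩
        rw [← Ext.comp_neg, of_comp_eq_smul, of_comp_eq_smul]
        exact ⟨Submodule.smul_mem _ _ (ih b), Submodule.smul_mem _ _ (ih b)⟩
      · rw [neg_zero, map_zero]
        exact ⟨Submodule.zero_mem _, Submodule.zero_mem _⟩
      · intro a b _ _ ha hb
        rw [neg_add, map_add, map_add]
        exact ⟨Submodule.add_mem _ ha.1 hb.1, Submodule.add_mem _ ha.2 hb.2⟩
      · intro a _ ha
        rw [neg_neg]
        exact ha.symm
  rw [eq_top_iff]
  intro x _
  induction x using DirectSum.induction_on with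
  | zero => exact Submodule.zero_mem _
  | of n x => exact key n x
  | add x y hx hy => exact Submodule.add_mem _ (hx trivial) (hy trivial)

end Main

end EPSS

theorem proposition2p11 {k : Type v} {A : Type u} [Field k] [IsAlgClosed k] [Ring A] [Algebra k A]
    [Module.Finite k A] (hA : EPSS.IsBasic A)
    {Λ : Type u} [Finite Λ] [PartialOrder Λ] (Θ Q : Λ → ModuleCat.{u} A)
    (hΘQ : EPSS.IsEPSS Θ Q) (hst : EPSS.StandingConditions Θ Q)
    (hHom : Nonempty ((EPSS.dirSum Q →ₗ[A] EPSS.dirSum Θ)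
      ≃ₗ[Module.End A (EPSS.dirSum Θ)] (EPSS.dirSum Θ →ₗ[A] EPSS.dirSum Θ)))
    (hlin : ∀ l, EPSS.LinearlyFiltered Θ Q (Θ l))
    (M : ModuleCat.{u} A) (hM : EPSS.LinearlyFiltered Θ Q M) :
    (∀ i : ℕ, EPSS.extOneMul M (EPSS.dirSum Θ) i = ⊤) ∧
      Submodule.span (EPSS.ExtAlg (EPSS.dirSum Θ))
        (Set.range (DirectSum.of (EPSS.ExtFam M (EPSS.dirSum Θ)) 0)) = ⊤ := by
  have : IsNoetherianRing A := IsNoetherianRing.of_finite k A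
  choose p hp hpF using hΘQ.exact_seq
  have hker := EPSS.ker_le_ker_of_hom_equiv k hΘQ.finite_Θ hΘQ.finite_Q hHom p hp
  obtain ⟨-, i, X, ⟨e⟩, hsyz, hgen⟩ := hM
  -- All syzygies are treated at once, because degree `n + 1` for `X s` uses degree `n` for `X (s +
  -- 1)`.
  have hX : ∀ n s, EPSS.extOneMul (X s) (EPSS.dirSum Θ) n = ⊤ := by
    intro n
    induction n with
    | zero =>
      intro s
      exact EPSS.extOneMul_zero_eq_top hΘQ hst p hp hker (hsyz s) (hgen s)
        (by simpa only [add_assoc] using hgen (s + 1))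
    | succ n ih => exact fun s => EPSS.extOneMul_succ_eq_top hst (hsyz s) (ih (s + 1))
  have hMt : ∀ n, EPSS.extOneMul M (EPSS.dirSum Θ) n = ⊤ := fun n =>
    EPSS.extOneMul_eq_top_of_iso e.toModuleIso (hX n 0)
  exact ⟨hMt, EPSS.span_range_of_zero_eq_top hMt⟩
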